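/- Let $k$ be a field and let $H$ be a (left and right) noetherian Hopf algebra over $k$, with comultiplication $\Delta(h)=\sum h_1\otimes h_2$ and counit $\varepsilon$. Let $A\subseteq H$ be a (unital, associative) $k$-subalgebra such that $H$ is a finite centralizing extension of $A$, i.e. $H=Ar_1+\cdots+Ar_n$ for some $r_1,\dots,r_n\in H$ with $ar_i=r_ia$ for all $a\in A$ and all $i$. Assume that $A$ is a right coideal of $H$, i.e. $\Delta(A)\subseteq A\otimes H$. Let $X$ be the set of characters $\chi\colon H\to k$ (that is, $k$-algebra homomorphisms) with $\chi|_A=\varepsilon|_A$; under convolution it is a subgroup of the group of characters of $H$. For a character $\chi$ let $\sigma_\chi\colon h\mapsto\sum\chi(h_1)h_2$ be the corresponding winding automorphism of $H$. Write $\operatorname{spec}$ for the set of (two-sided) prime ideals and $\operatorname{prim}$ for the set of left primitive ideals of a ring; the $X$-orbit of an ideal $P$ of $H$ is $\{\sigma_\chi(P)\mid\chi\in X\}$. Let $A^+=\ker(\varepsilon|_A)$. Then $X$ is finite, each $\sigma_\chi$ with $\chi\in X$ fixes $A$ pointwise, and $P\mapsto P\cap A$ defines surjections $\operatorname{prim}H\twoheadrightarrow\operatorname{prim}A$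 and $\operatorname{spec}H\twoheadrightarrow\operatorname{spec}A$. Moreover, the following conditions are equivalent: (i) every irreducible left $H$-module $M$ restricting to the counit on $A$ (i.e. $am=\varepsilon(a)m$ for all $a\in A$, $m\in M$) is one-dimensional over $k$; (ii) the primitive ideals $P$ of $H$ with $P\cap A=A^+$ form a single $X$-orbit in $\operatorname{prim}H$; (iii) the fibers of the surjection $\operatorname{prim}H\twoheadrightarrow\operatorname{prim}A$ are precisely the $X$-orbits in $\operatorname{prim}H$; (iv) the fibers of the surjection $\operatorname{spec}H\twoheadrightarrow\operatorname{spec}A$ are precisely the $X$-orbits in $\operatorname{spec}H$. -/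

import Mathlib

open scoped TensorProduct

universe u v

namespace CentralizingHopf

section Rings

variable {R : Type v} [Ring R]

/-- A two-sided ideal `P` of a (noncommutative) ring is prime: it is proper, and
`a R b ⊆ P` implies `a ∈ P` or `b ∈ P`. -/
def IsPrimeIdeal (P : TwoSidedIdeal R) : Prop :=
  P ≠ ⊤ ∧ ∀ a b : R, (∀ r : R, a * r * b ∈ P) → a ∈ P ∨ b ∈ P

/-- A two-sided ideal is (left) primitive: it is the annihilator of a simple left module. -/
def IsPrimitiveIdeal (P : TwoSidedIdeal R) : Prop :=
  ∃ (M : Type v) (_ : AddCommGroup M) (_ : Module R M),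
    IsSimpleModule R M ∧ ∀ r : R, r ∈ P ↔ ∀ m : M, r • m = 0

variable (R) in
/-- `spec R`, the set of prime ideals of `R`. -/
def spec : Set (TwoSidedIdeal R) := {P | IsPrimeIdeal P}

variable (R) in
/-- `prim R`, the set of (left) primitive ideals of `R`. -/
def prim : Set (TwoSidedIdeal R) := {P | IsPrimitiveIdeal P}

end Rings

section Extension

variable {k : Type u} {H : Type v} [Field k] [Ring H] [Algebra k H]

/-- `H` is a finite centralizing extension of its subalgebra `A`:
`H = A r₁ + ⋯ + A rₙ` for elements `rᵢ` commuting with every element of `A`. -/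
def IsFiniteCentralizing (A : Subalgebra k H) : Prop :=
  ∃ s : Finset H, (∀ r ∈ s, ∀ a ∈ A, a * r = r * a) ∧
    Submodule.span A (s : Set H) = ⊤

/-- The contraction `P ↦ P ∩ A`. -/
def contract (A : Subalgebra k H) (P : TwoSidedIdeal H) : TwoSidedIdeal A :=
  P.comap A.val

/-- The fiber over `Q` of the contraction map restricted to the set `S` of ideals of `H`. -/
def fiber (A : Subalgebra k H) (S : Set (TwoSidedIdeal H)) (Q : TwoSidedIdeal A) :
    Set (TwoSidedIdeal H) :=
  {P | P ∈ S ∧ contract A P = Q}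

end Extension

section Hopf

variable {k : Type u} {H : Type v} [Field k] [Ring H] [HopfAlgebra k H]

/-- `A` is a right coideal of `H`: `Δ(A) ⊆ A ⊗ H`. -/
def IsRightCoideal (A : Subalgebra k H) : Prop :=
  ∀ a ∈ A, Coalgebra.comul (R := k) a ∈
    LinearMap.range (LinearMap.rTensor H A.val.toLinearMap)

/-- The augmentation ideal `A⁺` of `A`, the kernel of the restriction of the counit. -/
def augmentationIdeal (A : Subalgebra k H) : TwoSidedIdeal A :=
  TwoSidedIdeal.ker ((Bialgebra.counitAlgHom k H).comp A.val)

/-- The (right) winding endomorphism `σ_χ : b ↦ ∑ χ(b₁) b₂`. -/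
noncomputable def windingHom (χ : H →ₐ[k] k) : H →ₐ[k] H :=
  (Algebra.TensorProduct.lid k H).toAlgHom.comp
    ((Algebra.TensorProduct.map χ (AlgHom.id k H)).comp (Bialgebra.comulAlgHom k H))

/-- The convolution inverse `χ ∘ S` of a character `χ`. -/
noncomputable def charInv (χ : H →ₐ[k] k) : H →ₐ[k] k :=
  AlgHom.ofLinearMap (χ.toLinearMap ∘ₗ HopfAlgebra.antipode k) (by simp)
    (fun x y => by simp [HopfAlgebra.antipode_mul_antidistrib, mul_comm])

lemma conv_apply (χ ψ : WithConv (H →ₐ[k] k)) (h : H) {ι : Type*}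
    (r : Coalgebra.Repr k h ι) :
    (χ * ψ).ofConv h = ∑ i ∈ r.index, χ.ofConv (r.left i) * ψ.ofConv (r.right i) := by
  rw [AlgHom.convMul_def]
  simp [← r.eq]

/-- The characters of a Hopf algebra form a group under convolution
`(χ * ψ)(h) = ∑ χ(h₁) ψ(h₂)`, with neutral element the counit. -/
noncomputable instance characterGroup : Group (WithConv (H →ₐ[k] k)) where
  inv χ := WithConv.toConv (charInv χ.ofConv)
  inv_mul_cancel χ := by
    apply WithConv.ofConv_injective
    ext h
    have e := congrArg χ.ofConv
      (HopfAlgebra.sum_antipode_mul_eq_algebraMap_counit (Coalgebra.Repr.arbitrary k h))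
    rw [conv_apply _ _ h (Coalgebra.Repr.arbitrary k h)]
    simp only [map_sum, map_mul, AlgHom.commutes] at e
    exact e

lemma windingHom_apply (χ : H →ₐ[k] k) (h : H) {ι : Type*} (r : Coalgebra.Repr k h ι) :
    windingHom χ h = ∑ i ∈ r.index, χ (r.left i) • r.right i := by
  simp [windingHom, ← r.eq]

lemma windingHom_one : windingHom (1 : WithConv (H →ₐ[k] k)).ofConv = AlgHom.id k H := by
  ext h
  rw [windingHom_apply _ h (Coalgebra.Repr.arbitrary k h)]
  simpa [AlgHom.convOne_def, Algebra.ofId_apply] using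
    Coalgebra.sum_counit_smul (Coalgebra.Repr.arbitrary k h)

/-- The composition law `σ_χ ∘ σ_ψ = σ_{ψ * χ}` of winding endomorphisms. -/
lemma windingHom_comp (χ ψ : WithConv (H →ₐ[k] k)) :
    (windingHom χ.ofConv).comp (windingHom ψ.ofConv) = windingHom (ψ * χ).ofConv := by
  ext h
  let Φ : H ⊗[k] (H ⊗[k] H) →ₗ[k] H :=
    (TensorProduct.lid k H).toLinearMap ∘ₗ TensorProduct.map ψ.ofConv.toLinearMap
      ((TensorProduct.lid k H).toLinearMap ∘ₗ
        TensorProduct.map χ.ofConv.toLinearMap LinearMap.id)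
  have key := congrArg Φ (Coalgebra.coassoc_apply (R := k) h)
  have h1 : ∀ t : H ⊗[k] H, Φ (TensorProduct.assoc k H H H (Coalgebra.comul.rTensor H t)) =
      TensorProduct.lid k H
        (TensorProduct.map (ψ * χ).ofConv.toLinearMap LinearMap.id t) := by
    intro t
    induction t with
    | zero => simp
    | add x y hx hy => simp only [map_add, hx, hy]
    | tmul x y =>
      have := conv_apply ψ χ x (Coalgebra.Repr.arbitrary k x)
      simp only [LinearMap.rTensor_tmul, TensorProduct.map_tmul, AlgHom.toLinearMap_apply,
        LinearMap.id_apply, TensorProduct.lid_tmul, this,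
        ← (Coalgebra.Repr.arbitrary k x).eq, TensorProduct.sum_tmul, map_sum]
      exact Finset.sum_congr rfl fun i _ => by
        simp only [Φ, mul_smul, TensorProduct.assoc_tmul, TensorProduct.map_tmul,
          AlgHom.toLinearMap_apply, LinearMap.id_apply, TensorProduct.lid_tmul,
          LinearMap.comp_apply, LinearEquiv.coe_coe]
  have h2 : ∀ t : H ⊗[k] H, Φ (Coalgebra.comul.lTensor H t) =
      windingHom χ.ofConv (TensorProduct.lid k H
        (TensorProduct.map ψ.ofConv.toLinearMap LinearMap.id t)) := by
    intro t
    induction t with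
    | zero => simp
    | add x y hx hy => simp only [map_add, hx, hy]
    | tmul x y =>
      simp only [Φ, LinearMap.lTensor_tmul, TensorProduct.map_tmul, AlgHom.toLinearMap_apply,
        LinearMap.id_apply, TensorProduct.lid_tmul, LinearMap.comp_apply, map_smul,
        LinearEquiv.coe_coe]
      rfl
  rw [h1, h2] at key
  exact key.symm

/-- The winding automorphism `σ_χ` of a Hopf algebra, with inverse `σ_{χ⁻¹}`. -/
noncomputable def winding (χ : WithConv (H →ₐ[k] k)) : H ≃ₐ[k] H :=
  AlgEquiv.ofAlgHom (windingHom χ.ofConv) (windingHom χ⁻¹.ofConv)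
    (by rw [windingHom_comp, inv_mul_cancel, windingHom_one])
    (by rw [windingHom_comp, mul_inv_cancel, windingHom_one])

lemma windingHom_eq_self {A : Subalgebra k H} (hA : IsRightCoideal A) {χ : H →ₐ[k] k}
    (hχ : ∀ a ∈ A, χ a = Coalgebra.counit (R := k) a) {a : H} (ha : a ∈ A) :
    windingHom χ a = a := by
  obtain ⟨t, ht⟩ := hA a ha
  have h1 : ∀ t : A ⊗[k] H,
      TensorProduct.map χ.toLinearMap LinearMap.id (LinearMap.rTensor H A.val.toLinearMap t) =
      LinearMap.rTensor H Coalgebra.counit (LinearMap.rTensor H A.val.toLinearMap t) := by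
    intro t
    induction t with
    | zero => simp
    | add x y hx hy => simp only [map_add, hx, hy]
    | tmul x y => simp [hχ x x.2]
  have h2 := h1 t
  rw [ht, Coalgebra.rTensor_counit_comul] at h2
  have h3 : windingHom χ a = TensorProduct.lid k H
    (TensorProduct.map χ.toLinearMap LinearMap.id (Coalgebra.comul a)) := rfl
  rw [h3, h2]
  simp

lemma conv_apply' (χ ψ : WithConv (H →ₐ[k] k)) (h : H) :
    (χ * ψ).ofConv h = ψ.ofConv (windingHom χ.ofConv h) := by
  rw [windingHom_apply _ h (Coalgebra.Repr.arbitrary k h),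
    conv_apply _ _ h (Coalgebra.Repr.arbitrary k h)]
  simp

/-- The group `X` of characters of `H` that restrict to the counit on the right coideal
subalgebra `A`. -/
noncomputable def restrictingCharacters (A : Subalgebra k H) (hA : IsRightCoideal A) :
    Subgroup (WithConv (H →ₐ[k] k)) where
  carrier := {χ | ∀ a ∈ A, χ.ofConv a = Coalgebra.counit (R := k) a}
  one_mem' := fun a _ => by simp [AlgHom.convOne_def]
  mul_mem' := fun {χ ψ} hχ hψ a ha => by
    rw [conv_apply', windingHom_eq_self hA hχ ha, hψ a ha]
  inv_mem' := fun {χ} hχ a ha => by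
    have h := conv_apply' χ χ⁻¹ a
    rw [windingHom_eq_self hA hχ ha, mul_inv_cancel] at h
    rw [← h]
    simp [AlgHom.convOne_def]

/-- The orbit `{σ_χ(P) | χ ∈ X}` of an ideal `P` under a group `X` of characters acting by
winding automorphisms. -/
def windingOrbit (X : Subgroup (WithConv (H →ₐ[k] k))) (P : TwoSidedIdeal H) :
    Set (TwoSidedIdeal H) :=
  {P' | ∃ χ ∈ X, P' = (winding χ).toRingEquiv.mapTwoSidedIdeal P}

/-- Every irreducible left `H`-module on which `A` acts through the counit is
one-dimensional over `k`. -/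
def IrreduciblesOneDimensional (A : Subalgebra k H) : Prop :=
  ∀ (M : Type v) [AddCommGroup M] [Module k M] [Module H M] [IsScalarTower k H M]
    [IsSimpleModule H M],
    (∀ a ∈ A, ∀ m : M, a • m = Coalgebra.counit (R := k) a • m) → Module.finrank k M = 1

end Hopf

end CentralizingHopf

/-!
Write `C` for the centralizer of `A` in `H`, so that `H = A C`. Everything rests on one fact about
centralizing extensions (`exists_isLayer`): for a prime ideal `Q` of `A` and a sub-bimodule `K₀` of
`H` with `ann_A (H / K₀) ⊆ Q` there are nonzero left linear and right linear maps from `H / K₀` to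
`A / Q`. Indeed, if the centralizing generators are added to `K₀` one by one, some generator `r`
makes the annihilator leave `Q`; an element `b ∉ Q` of the new annihilator maps `H` into `K + A r`,
where `K` is the previous bimodule, and `(K + A r) / K` is a quotient of `A` that maps onto `A / Q`.
This yields lying over for prime and for primitive ideals
(`exists_isPrimeIdeal_contract_eq`, `exists_isPrimitiveIdeal_contract_eq`). It also gives, for two
primes `P`, `P'` of `H` with the same contraction, a nonzero `A`-linear map `f : H / P' → H / P`
(`exists_linearMap_quotient`).

The Hopf structure turns `f` into a winding automorphism. For `H`-modules `N` and `M` let `H` act on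
`Hom_k(N, M)` by `(h · f)(n) = ∑ h₁ f(S(h₂) n)`. Since `A` is a right coideal, it acts on `A`-linear
maps through the counit (`adjoint_apply_of_linear`), so `H · f` is finite-dimensional over `k` and
`A` acts on all of it through the counit. If such irreducible modules are one-dimensional, then
`H · f` contains an eigenvector `w ≠ 0` whose character `χ` belongs to `X` (`exists_eigenvector`),
and being an eigenvector means `h w(n) = w(σ_χ(h) n)` (`smul_apply_of_eigenvector`). For
`N = H / P'` and `M = H / P` this forces `P' ⊆ σ_χ(P)`. By symmetry `P ⊆ σ_ψ(P')` for some `ψ ∈ X`,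
and finiteness of `X`, which is the linear independence of characters, makes both inclusions
equalities (`mem_windingOrbit_of_contract_eq`).

Conversely, the kernel of the counit lies over `A⁺`. If the fiber over `A⁺` is a single orbit, its
members are therefore kernels of characters, and an irreducible module annihilated by such a kernel
is one-dimensional (`irreduciblesOneDimensional_of_fiber_eq`).
-/

namespace CentralizingHopf

/-! ### Finite centralizing extensions -/

section Extension

variable {k : Type u} {H : Type v} [Field k] [Ring H] [Algebra k H] {A : Subalgebra k H}

/-- Every element of a finite centralizing extension of `A` is a sum of elements `a * r` with
`a ∈ A` and `r` in the centralizer of `A`. -/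
lemma IsFiniteCentralizing.induction (hc : IsFiniteCentralizing A) {p : H → Prop}
    (zero : p 0) (add : ∀ x y, p x → p y → p (x + y))
    (mul : ∀ (a : A) (r : H), (∀ a' : A, (a' : H) * r = r * a') → p (a * r)) (h : H) : p h := by
  obtain ⟨s, hs, hspan⟩ := hc
  have hh : h ∈ Submodule.span A (s : Set H) := hspan ▸ Submodule.mem_top
  induction hh using Submodule.span_induction with
  | mem x hx => simpa using mul 1 x fun a' => hs x hx a' a'.2
  | zero => exact zero
  | add x y _ _ hx hy => exact add x y hx hy
  | smul a x _ hx =>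
    clear hx
    rename_i hx
    induction hx using Submodule.span_induction generalizing a with
    | mem x hx => exact mul a x fun a' => hs x hx a' a'.2
    | zero => simpa using zero
    | add x y _ _ hx hy => rw [smul_add]; exact add _ _ (hx a) (hy a)
    | smul b x _ hx => rw [← mul_smul]; exact hx _

lemma mem_contract {P : TwoSidedIdeal H} {a : A} : a ∈ contract A P ↔ (a : H) ∈ P :=
  TwoSidedIdeal.mem_comap _

/-- A layer of the `A`-bimodule `H` over a prime ideal `Q` of `A`: for a sub-bimodule `K` and an
element `r` centralizing `A`, the cyclic subquotient `(K + A r) / K ≅ A / ann` has annihilator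
inside `Q`, and multiplication by some `b ∉ Q`, on either side, maps `H` into `K + A r`.
Sending `h` to the class modulo `Q` of an `a` with `h b - a r ∈ K` is then a nonzero left linear
map `H → A / Q`, and `b h - a r ∈ K` gives a nonzero right linear one. -/
structure IsLayer (Q : TwoSidedIdeal A) (K : Submodule A H) (r : H) (b : A) : Prop where
  comm : ∀ a : A, (a : H) * r = r * a
  notMem : b ∉ Q
  mul_mem : ∀ x ∈ K, ∀ a : A, x * a ∈ K
  mem_of_mul_mem : ∀ a : A, (a : H) * r ∈ K → a ∈ Q
  exists_left : ∀ h : H, ∃ a : A, (b : H) * h - a * r ∈ K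
  exists_right : ∀ h : H, ∃ a : A, h * (b : H) - a * r ∈ K

/-- The key lemma on finite centralizing extensions. Adding the centralizing generators of `H` to
`K₀` one at a time, the annihilator of the quotient of `H` grows from an ideal inside `Q` to all
of `A`; the first step at which it leaves `Q` is a layer. -/
lemma exists_isLayer (hc : IsFiniteCentralizing A) {Q : TwoSidedIdeal A} (hQ : IsPrimeIdeal Q)
    (K₀ : Submodule A H) (hK₀ : ∀ x ∈ K₀, ∀ a : A, x * a ∈ K₀)
    (hann : ∀ a : A, (∀ h : H, (a : H) * h ∈ K₀) → a ∈ Q) :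
    ∃ K r b, K₀ ≤ K ∧ IsLayer Q K r b := by
  obtain ⟨s, hs, hspan⟩ := id hc
  have htop : K₀ ⊔ Submodule.span A (s : Set H) = ⊤ := by rw [hspan]; simp
  clear hspan
  classical
  induction s using Finset.induction_on generalizing K₀ with
  | empty =>
    refine absurd ?_ hQ.1
    have htop' : K₀ = ⊤ := by simpa using htop
    exact TwoSidedIdeal.ext fun a => ⟨fun _ => trivial, fun _ => hann a fun h => by simp [htop']⟩
  | insert r s hrs ih =>
    have hr : ∀ a : A, (a : H) * r = r * a := fun a => hs r (by simp) a a.2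
    let K₁ : Submodule A H := K₀ ⊔ Submodule.span A {r}
    have mem_K₁ : ∀ x, x ∈ K₁ ↔ ∃ a : A, x - a * r ∈ K₀ := by
      intro x
      simp only [K₁, Submodule.mem_sup, Submodule.mem_span_singleton]
      constructor
      · rintro ⟨y, hy, _, ⟨a, rfl⟩, rfl⟩
        exact ⟨a, by simpa [Subalgebra.smul_def] using hy⟩
      · rintro ⟨a, ha⟩
        exact ⟨_, ha, _, ⟨a, rfl⟩, by simp [Subalgebra.smul_def]⟩
    have hK₁ : ∀ x ∈ K₁, ∀ a : A, x * a ∈ K₁ := by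
      intro x hx a
      obtain ⟨c, hx⟩ := (mem_K₁ x).1 hx
      refine (mem_K₁ _).2 ⟨c * a, ?_⟩
      have := hK₀ _ hx a
      rwa [sub_mul, mul_assoc (c : H), ← hr, ← mul_assoc] at this
    by_cases hann₁ : ∀ a : A, (∀ h : H, (a : H) * h ∈ K₁) → a ∈ Q
    · obtain ⟨K, r', b, hK, hL⟩ := ih K₁ hK₁ hann₁
        (fun r' hr' => hs r' (Finset.mem_insert_of_mem hr')) (by
          rw [← htop, Finset.coe_insert, Submodule.span_insert, sup_assoc])
      exact ⟨K, r', b, le_sup_left.trans hK, hL⟩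
    · push Not at hann₁
      obtain ⟨b, hb, hbQ⟩ := hann₁
      refine ⟨K₀, r, b, le_rfl, hr, hbQ, hK₀, fun a ha => ?_, fun h => (mem_K₁ _).1 (hb h),
        fun h => (mem_K₁ _).1 ?_⟩
      · -- `a A b` annihilates `H / K₀`, since `A b` maps `H` into `K₁` and `a` maps `K₁` into `K₀`
        refine (hQ.2 a b fun c => hann _ fun h => ?_).resolve_right hbQ
        obtain ⟨d, hd⟩ := (mem_K₁ _).1 (hb h)
        have h1 : ((a * c : A) : H) * (b * h - d * r) ∈ K₀ := K₀.smul_mem (a * c) hd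
        have h2 := hK₀ _ ha (c * d)
        have h3 : (a : H) * r * ((c * d : A) : H) = ((a * c : A) : H) * (d * r) := by
          rw [mul_assoc, ← hr]; push_cast; noncomm_ring
        rw [h3] at h2
        have := K₀.add_mem h1 h2
        rw [mul_sub, sub_add_cancel] at this
        push_cast at this ⊢
        rwa [mul_assoc (_ * _)]
      · refine hc.induction (p := fun h => h * (b : H) ∈ K₁) (by simp)
          (fun x y hx hy => by rw [add_mul]; exact K₁.add_mem hx hy) (fun a t ht => ?_) h
        rw [mul_assoc, ← ht]
        exact K₁.smul_mem a (hb t)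

/-! ### Contraction of ideals -/

lemma isPrimeIdeal_contract (hc : IsFiniteCentralizing A) {P : TwoSidedIdeal H}
    (hP : IsPrimeIdeal P) : IsPrimeIdeal (contract A P) := by
  refine ⟨fun h => hP.1 ?_, fun a b hab => ?_⟩
  · have h1 : (1 : A) ∈ contract A P := h ▸ TwoSidedIdeal.mem_top _
    exact (TwoSidedIdeal.one_mem_iff P).1 (mem_contract.1 h1)
  · simp only [mem_contract] at hab ⊢
    refine hP.2 _ _ fun h => ?_
    refine hc.induction (p := fun h => (a : H) * h * b ∈ P) (by simp)
      (fun x y hx hy => by rw [mul_add, add_mul]; exact P.add_mem hx hy) (fun c t ht => ?_) h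
    rw [← mul_assoc, mul_assoc _ t, ← ht, ← mul_assoc]
    exact P.mul_mem_right _ _ (hab c)

/-- Every prime ideal of `A` is contracted from an ideal of `H`: with `f : H → A / Q` the left
linear map of a layer, take `{x | f (H x H) = 0}`. -/
lemma exists_contract_eq (hc : IsFiniteCentralizing A) {Q : TwoSidedIdeal A}
    (hQ : IsPrimeIdeal Q) : ∃ T : TwoSidedIdeal H, contract A T = Q := by
  obtain ⟨K, r, b, -, hL⟩ := exists_isLayer hc hQ ⊥ (by simp) (fun a ha => by
    have : a = 0 := by simpa using ha 1
    exact this ▸ Q.zero_mem)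
  let T : TwoSidedIdeal H := .mk' {x | ∀ h h' : H, ∃ c ∈ Q, h * x * h' * b - c * r ∈ K}
    (fun h h' => ⟨0, Q.zero_mem, by simp⟩)
    (fun {x y} hx hy h h' => by
      obtain ⟨c, hc, h1⟩ := hx h h'
      obtain ⟨d, hd, h2⟩ := hy h h'
      refine ⟨c + d, Q.add_mem hc hd, ?_⟩
      convert K.add_mem h1 h2 using 1
      push_cast; noncomm_ring)
    (fun {x} hx h h' => by
      obtain ⟨c, hc, h1⟩ := hx h h'
      refine ⟨-c, Q.neg_mem hc, ?_⟩
      convert K.neg_mem h1 using 1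
      push_cast; noncomm_ring)
    (fun {x y} hy h h' => by simpa only [mul_assoc] using hy (h * x) h')
    (fun {x y} hy h h' => by simpa only [mul_assoc] using hy h (y * h'))
  have mem_T : ∀ x, x ∈ T ↔ ∀ h h' : H, ∃ c ∈ Q, h * x * h' * b - c * r ∈ K :=
    fun x => TwoSidedIdeal.mem_mk' _ _ _ _ _ _ _
  refine ⟨T, TwoSidedIdeal.ext fun q => ?_⟩
  rw [mem_contract, mem_T]
  constructor
  · intro hq
    refine (hQ.2 q b fun a => ?_).resolve_right hL.notMem
    obtain ⟨c, hcQ, hcK⟩ := hq 1 (a * r)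
    have : q * a * b - c ∈ Q := by
      refine hL.mem_of_mul_mem _ ?_
      convert hcK using 1
      push_cast
      rw [sub_mul, mul_assoc _ (b : H), hL.comm]
      noncomm_ring
    simpa using Q.add_mem this hcQ
  · intro hq h h'
    refine hc.induction (p := fun h => ∃ c ∈ Q, h * q * h' * b - c * r ∈ K)
      ⟨0, Q.zero_mem, by simp⟩ ?_ (fun a t ht => ?_) h
    · rintro x y ⟨c, hc, h1⟩ ⟨d, hd, h2⟩
      refine ⟨c + d, Q.add_mem hc hd, ?_⟩
      convert K.add_mem h1 h2 using 1
      push_cast; noncomm_ring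
    · obtain ⟨c, hcK⟩ := hL.exists_right (t * h')
      refine ⟨a * q * c, Q.mul_mem_right _ _ (Q.mul_mem_left _ _ hq), ?_⟩
      convert K.smul_mem (a * q) hcK using 1
      rw [Subalgebra.smul_def, smul_eq_mul, mul_assoc (a : H), ← ht]
      push_cast; noncomm_ring

/-- Lying over for prime ideals. -/
lemma exists_isPrimeIdeal_contract_eq (hn : IsNoetherianRing H) (hc : IsFiniteCentralizing A)
    {Q : TwoSidedIdeal A} (hQ : IsPrimeIdeal Q) :
    ∃ P : TwoSidedIdeal H, IsPrimeIdeal P ∧ contract A P = Q := by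
  obtain ⟨T, hT⟩ := exists_contract_eq hc hQ
  have hwf : WellFoundedGT (TwoSidedIdeal H) :=
    StrictMono.wellFoundedGT (f := TwoSidedIdeal.asIdeal (R := H))
      (TwoSidedIdeal.asIdeal.monotone.strictMono_of_injective fun I J h =>
        TwoSidedIdeal.ext fun x => by
          rw [← TwoSidedIdeal.mem_asIdeal, h, TwoSidedIdeal.mem_asIdeal])
  obtain ⟨P, ⟨hTP, hPQ⟩, hmax⟩ := hwf.wf.has_min
    {I : TwoSidedIdeal H | T ≤ I ∧ contract A I ≤ Q} ⟨T, le_rfl, hT.le⟩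
  -- an ideal strictly above `P` contains an element of `A` outside `Q`
  have key : ∀ I : TwoSidedIdeal H, P ≤ I → (∃ x ∈ I, x ∉ P) → ∃ a : A, (a : H) ∈ I ∧ a ∉ Q := by
    rintro I hPI ⟨x, hxI, hxP⟩
    by_contra! hcon
    exact hmax I ⟨hTP.trans hPI, fun a ha => hcon a (mem_contract.1 ha)⟩
      (lt_of_le_of_ne hPI fun h => hxP (h ▸ hxI))
  refine ⟨P, ⟨fun h => hQ.1 (top_le_iff.1 fun a _ => hPQ (mem_contract.2 (h ▸ trivial))), ?_⟩,
    le_antisymm hPQ (hT.ge.trans (TwoSidedIdeal.comap_le_comap _ hTP))⟩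
  intro x y hxy
  by_contra! hcon
  obtain ⟨hx, hy⟩ := hcon
  let I : TwoSidedIdeal H := .mk' {u | ∀ h, u * h * y ∈ P} (fun h => by simp)
    (fun hu hv h => by rw [add_mul, add_mul]; exact P.add_mem (hu h) (hv h))
    (fun hu h => by rw [neg_mul, neg_mul]; exact P.neg_mem (hu h))
    (fun {g u} hu h => by rw [mul_assoc g, mul_assoc g]; exact P.mul_mem_left _ _ (hu h))
    (fun {u g} hu h => by rw [mul_assoc u]; exact hu _)
  obtain ⟨a, haI, haQ⟩ := key I
    (fun u hu => (TwoSidedIdeal.mem_mk' _ _ _ _ _ _ _).2 fun h =>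
      P.mul_mem_right _ _ (P.mul_mem_right _ _ hu))
    ⟨x, (TwoSidedIdeal.mem_mk' _ _ _ _ _ _ _).2 hxy, hx⟩
  have ha : ∀ h, (a : H) * h * y ∈ P := (TwoSidedIdeal.mem_mk' _ _ _ _ _ _ _).1 haI
  let J : TwoSidedIdeal H := .mk' {v | ∀ h, (a : H) * h * v ∈ P} (fun h => by simp)
    (fun hu hv h => by rw [mul_add]; exact P.add_mem (hu h) (hv h))
    (fun hu h => by rw [mul_neg]; exact P.neg_mem (hu h))
    (fun {g u} hu h => by rw [← mul_assoc, mul_assoc _ h]; exact hu _)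
    (fun {u g} hu h => by rw [← mul_assoc]; exact P.mul_mem_right _ _ (hu h))
  obtain ⟨c, hcJ, hcQ⟩ := key J
    (fun u hu => (TwoSidedIdeal.mem_mk' _ _ _ _ _ _ _).2 fun h => P.mul_mem_left _ _ hu)
    ⟨y, (TwoSidedIdeal.mem_mk' _ _ _ _ _ _ _).2 ha, hy⟩
  have hac : ∀ h, (a : H) * h * c ∈ P := (TwoSidedIdeal.mem_mk' _ _ _ _ _ _ _).1 hcJ
  rcases hQ.2 a c fun d => hPQ (mem_contract.2 (hac d)) with h | h
  exacts [haQ h, hcQ h]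

end Extension

section Primitive

/-! ### Primitive ideals -/

variable {R : Type v} [Ring R]

lemma exists_smul_eq_of_isSimpleModule {M : Type*} [AddCommGroup M] [Module R M]
    [IsSimpleModule R M] {m : M} (hm : m ≠ 0) (x : M) : ∃ r : R, r • m = x :=
  IsSimpleModule.toSpanSingleton_surjective R hm x

lemma IsPrimitiveIdeal.isPrimeIdeal {P : TwoSidedIdeal R} (hP : IsPrimitiveIdeal P) :
    IsPrimeIdeal P := by
  obtain ⟨M, _, _, hM, hann⟩ := hP
  have := IsSimpleModule.nontrivial R M
  refine ⟨fun h => ?_, fun a b hab => ?_⟩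
  · obtain ⟨m, hm⟩ := exists_ne (0 : M)
    exact hm (by simpa using (hann 1).1 (h ▸ trivial) m)
  · by_contra! hcon
    simp only [hann] at hcon hab
    push Not at hcon
    obtain ⟨⟨x, hx⟩, y, hy⟩ := hcon
    obtain ⟨r, rfl⟩ := exists_smul_eq_of_isSimpleModule (R := R) hy x
    exact hx (by simpa only [mul_smul] using hab r y)

/-- The annihilator of a module, as a two-sided ideal. -/
def annIdeal (R : Type*) [Ring R] (M : Type*) [AddCommGroup M] [Module R M] : TwoSidedIdeal R :=
  TwoSidedIdeal.ker (Module.toAddMonoidEnd R M)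

lemma mem_annIdeal {M : Type*} [AddCommGroup M] [Module R M] {r : R} :
    r ∈ annIdeal R M ↔ ∀ m : M, r • m = 0 := by
  rw [annIdeal, TwoSidedIdeal.mem_ker, DFunLike.ext_iff]
  rfl

lemma isPrimitiveIdeal_annIdeal (M : Type v) [AddCommGroup M] [Module R M]
    [hM : IsSimpleModule R M] : IsPrimitiveIdeal (annIdeal R M) :=
  ⟨M, _, _, hM, fun _ => mem_annIdeal⟩

/-- Primitivity is preserved by ring automorphisms: twist the module. -/
lemma IsPrimitiveIdeal.comap {P : TwoSidedIdeal R} (hP : IsPrimitiveIdeal P) (e : R ≃+* R) :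
    IsPrimitiveIdeal (P.comap e) := by
  obtain ⟨M, _, inst, hM, hann⟩ := hP
  refine ⟨M, _, Module.compHom M e.toRingHom, ?_, fun r => ?_⟩
  · refine (@isSimpleModule_iff_toSpanSingleton_surjective R _ M _
      (Module.compHom M e.toRingHom)).2 ⟨IsSimpleModule.nontrivial R M, fun m hm x => ?_⟩
    obtain ⟨r, hr⟩ := exists_smul_eq_of_isSimpleModule (R := R) hm x
    refine ⟨e.symm r, ?_⟩
    change e (e.symm r) • m = x
    simpa using hr
  · rw [TwoSidedIdeal.mem_comap, hann]
    rfl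

lemma IsPrimeIdeal.comap {P : TwoSidedIdeal R} (hP : IsPrimeIdeal P) (e : R ≃+* R) :
    IsPrimeIdeal (P.comap e) := by
  refine ⟨fun h => hP.1 ?_, fun a b hab => ?_⟩
  · refine (TwoSidedIdeal.one_mem_iff P).1 ?_
    have : (1 : R) ∈ P.comap e := h ▸ trivial
    simpa [TwoSidedIdeal.mem_comap] using this
  · simp only [TwoSidedIdeal.mem_comap, map_mul] at hab ⊢
    exact hP.2 _ _ fun r => by simpa using hab (e.symm r)

end Primitive

section Extension

variable {k : Type u} {H : Type v} [Field k] [Ring H] [Algebra k H] {A : Subalgebra k H}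

/-- A simple `H`-module `M` has a simple `A`-quotient `M / M'`, with the same annihilator in `A`:
the elements `m` with `H m ⊆ M'` form a proper `H`-submodule, hence only `0`, and an element of
`A` mapping `M` into `M'` maps `M` into that submodule. -/
lemma isPrimitiveIdeal_contract (hc : IsFiniteCentralizing A) {P : TwoSidedIdeal H}
    (hP : IsPrimitiveIdeal P) : IsPrimitiveIdeal (contract A P) := by
  obtain ⟨M, _, _, hM, hann⟩ := hP
  have := IsSimpleModule.nontrivial H M
  obtain ⟨m, hm⟩ := exists_ne (0 : M)
  have hfin : Module.Finite A M := by
    have hH : Module.Finite A H := by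
      obtain ⟨s, -, hs⟩ := hc
      exact ⟨s, hs⟩
    exact Module.Finite.of_surjective ((LinearMap.toSpanSingleton H M m).restrictScalars A)
      (exists_smul_eq_of_isSimpleModule (R := H) hm)
  obtain ⟨M', hM'⟩ := IsCoatomic.exists_coatom (Submodule A M)
  have hsimple := isSimpleModule_iff_isCoatom.2 hM'
  refine ⟨M ⧸ M', _, _, hsimple, fun a => ?_⟩
  rw [mem_contract, hann]
  constructor
  · intro ha x
    obtain ⟨x, rfl⟩ := M'.mkQ_surjective x
    rw [← map_smul]
    have : a • x = 0 := ha x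
    rw [this, map_zero]
  · intro ha x
    have ha' : ∀ x : M, a • x ∈ M' := fun x => by
      have := ha (M'.mkQ x)
      rwa [← map_smul, Submodule.mkQ_apply, Submodule.Quotient.mk_eq_zero] at this
    let N : Submodule H M :=
      { carrier := {y | ∀ h : H, h • y ∈ M'}
        add_mem' := fun hx hy h => by rw [smul_add]; exact M'.add_mem (hx h) (hy h)
        zero_mem' := fun h => by simp
        smul_mem' := fun g y hy h => by rw [← mul_smul]; exact hy _ }
    have hN : N = ⊥ := (eq_bot_or_eq_top N).resolve_right fun h => hM'.1 (top_le_iff.1 fun y _ => by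
      have : y ∈ N := h ▸ Submodule.mem_top
      simpa using this 1)
    have hx : (a : H) • x ∈ N := by
      intro h
      refine hc.induction (p := fun h => h • (a : H) • x ∈ M') (by simp)
        (fun g g' hg hg' => by rw [add_smul]; exact M'.add_mem hg hg') (fun c t ht => ?_) h
      rw [mul_smul, ← mul_smul t, ← ht, mul_smul]
      exact M'.smul_mem c (ha' _)
    simpa [hN] using hx

/-- Lying over for primitive ideals. For a simple module `A / 𝔪`, a layer shows that `H 𝔪` is
proper, and a maximal left ideal of `H` above `H 𝔪` has the required annihilator. -/
lemma exists_isPrimitiveIdeal_contract_eq (hc : IsFiniteCentralizing A) {Q : TwoSidedIdeal A}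
    (hQ : IsPrimitiveIdeal Q) :
    ∃ P : TwoSidedIdeal H, IsPrimitiveIdeal P ∧ contract A P = Q := by
  obtain ⟨K, r, b, -, hL⟩ := exists_isLayer hc hQ.isPrimeIdeal ⊥ (by simp) (fun a ha => by
    have : a = 0 := by simpa using ha 1
    exact this ▸ Q.zero_mem)
  obtain ⟨L, _, _, hsimple, hann⟩ := hQ
  have := IsSimpleModule.nontrivial A L
  obtain ⟨l, hl⟩ := exists_ne (0 : L)
  have hann' : ∀ a : A, a ∈ Q ↔ ∀ c : A, (a * c) • l = 0 := by
    refine fun a => (hann a).trans ⟨fun h c => by rw [mul_smul, h], fun h m => ?_⟩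
    obtain ⟨c, rfl⟩ := exists_smul_eq_of_isSimpleModule (R := A) hl m
    rw [← mul_smul, h]
  let T : Ideal H :=
    { carrier := {x | ∀ h : H, ∃ c : A, c • l = 0 ∧ (b : H) * (h * x) - c * r ∈ K}
      zero_mem' := fun h => ⟨0, by simp, by simp⟩
      add_mem' := fun {x y} hx hy h => by
        obtain ⟨c, hc, h1⟩ := hx h
        obtain ⟨d, hd, h2⟩ := hy h
        refine ⟨c + d, by rw [add_smul, hc, hd, add_zero], ?_⟩
        convert K.add_mem h1 h2 using 1
        push_cast; noncomm_ring
      smul_mem' := fun g x hx h => by simpa only [smul_eq_mul, mul_assoc] using hx (h * g) }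
  have hmT : ∀ m : A, m • l = 0 → (m : H) ∈ T := by
    intro m hm h
    obtain ⟨c, hcK⟩ := hL.exists_left h
    refine ⟨c * m, by rw [mul_smul, hm, smul_zero], ?_⟩
    convert hL.mul_mem _ hcK m using 1
    push_cast
    rw [sub_mul, mul_assoc (c : H) (m : H), mul_assoc (c : H) r, hL.comm]
    noncomm_ring
  have hT : T ≠ ⊤ := by
    refine fun hT => hL.notMem ((hann' b).2 fun a => ?_)
    have h1 : (1 : H) ∈ T := hT ▸ Submodule.mem_top
    obtain ⟨c, hcl, hcK⟩ := h1 (a * r)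
    have : b * a - c ∈ Q := by
      refine hL.mem_of_mul_mem _ ?_
      convert hcK using 1
      push_cast; noncomm_ring
    have h2 := (hann _).1 this l
    rwa [sub_smul, hcl, sub_zero] at h2
  obtain ⟨N, hN, hTN⟩ := Ideal.exists_le_maximal T hT
  have hsN : IsSimpleModule H (H ⧸ N) := isSimpleModule_iff_isCoatom.2 hN.out
  have hmem : ∀ x : H, x ∈ annIdeal H (H ⧸ N) ↔ ∀ h, x * h ∈ N := by
    intro x
    rw [mem_annIdeal]
    constructor
    · intro hx h
      have := hx (N.mkQ h)
      rwa [← map_smul, Submodule.mkQ_apply, Submodule.Quotient.mk_eq_zero] at this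
    · intro hx m
      obtain ⟨h, rfl⟩ := N.mkQ_surjective m
      rw [← map_smul, Submodule.mkQ_apply, Submodule.Quotient.mk_eq_zero]
      exact hx h
  -- `N ∩ A` contains the maximal left ideal `ann l` and not `1`, so it equals `ann l`
  have hNl : ∀ a : A, (a : H) ∈ N → a • l = 0 := by
    intro a ha
    by_contra hal
    obtain ⟨c, hcl⟩ := exists_smul_eq_of_isSimpleModule (R := A) hal l
    have h1 := hTN (hmT (1 - c * a) (by rw [sub_smul, mul_smul, hcl, one_smul, sub_self]))
    have h2 := N.add_mem h1 (N.mul_mem_left (c : H) ha)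
    push_cast at h2
    rw [sub_add_cancel] at h2
    exact hN.ne_top ((Ideal.eq_top_iff_one N).2 h2)
  refine ⟨annIdeal H (H ⧸ N), isPrimitiveIdeal_annIdeal _, TwoSidedIdeal.ext fun a => ?_⟩
  rw [mem_contract, hmem, hann']
  constructor
  · intro ha c
    exact hNl _ (by simpa using ha c)
  · intro ha h
    refine hc.induction (p := fun h => (a : H) * h ∈ N) (by simp)
      (fun g g' hg hg' => by rw [mul_add]; exact N.add_mem hg hg') (fun c t ht => ?_) h
    have := N.mul_mem_left t (hTN (hmT _ (ha c)))
    rwa [← ht, MulMemClass.coe_mul, mul_assoc] at this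

end Extension

section Hopf

variable {k : Type u} {H : Type v} [Field k] [Ring H] [HopfAlgebra k H] {A : Subalgebra k H}

/-! ### The group of characters -/

lemma mem_restrictingCharacters {hA : IsRightCoideal A} {χ : WithConv (H →ₐ[k] k)} :
    χ ∈ restrictingCharacters A hA ↔ ∀ a ∈ A, χ.ofConv a = Coalgebra.counit (R := k) a :=
  Iff.rfl

/-- Linear forms `φ` with `φ (a h) = ε(a) φ(h)` are determined by their values on finitely many
generators, and distinct characters are linearly independent. -/
lemma finite_restrictingCharacters (hc : IsFiniteCentralizing A) (hA : IsRightCoideal A) :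
    Finite (restrictingCharacters A hA) := by
  obtain ⟨s, -, hs⟩ := hc
  let D : Submodule k (H →ₗ[k] k) :=
    { carrier := {φ | ∀ (a : A) (h : H), φ (a * h) = Coalgebra.counit (R := k) (a : H) * φ h}
      zero_mem' := by simp
      add_mem' := fun hx hy a h => by simp [hx a h, hy a h, mul_add]
      smul_mem' := fun c x hx a h => by simp [hx a h, mul_left_comm] }
  let ev : D →ₗ[k] (s → k) := LinearMap.pi fun r => LinearMap.applyₗ (r : H) ∘ₗ D.subtype
  have hev : Function.Injective ev := by
    refine fun φ ψ hφψ => Subtype.ext (LinearMap.ext fun h => ?_)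
    have hh : h ∈ Submodule.span A (s : Set H) := hs ▸ Submodule.mem_top
    induction hh using Submodule.span_induction with
    | mem x hx => exact congrFun hφψ ⟨x, hx⟩
    | zero => simp
    | add x y _ _ hx hy => rw [map_add, map_add, hx, hy]
    | smul a x _ hx => exact (φ.2 a x).trans ((congrArg _ hx).trans (ψ.2 a x).symm)
  have : Module.Finite k D := Module.Finite.of_injective ev hev
  have hli : LinearIndependent k (fun χ : restrictingCharacters A hA =>
      (⟨χ.1.ofConv.toLinearMap, fun a h => by
        have := mem_restrictingCharacters.1 χ.2 a a.2
        simp [this]⟩ : D)) := by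
    refine LinearIndependent.of_comp D.subtype ?_
    exact (linearIndependent_algHom_toLinearMap k H k).comp _
      (WithConv.ofConv_injective.comp Subtype.val_injective)
  exact hli.finite

/-! ### Eigenvectors -/

/-- The character by which `H` acts on a module that is one-dimensional over `k`. -/
lemma exists_algHom_of_finrank_eq_one {M : Type*} [AddCommGroup M] [Module k M] [Module H M]
    [IsScalarTower k H M] (hM : Module.finrank k M = 1) :
    ∃ χ : H →ₐ[k] k, ∀ (h : H) (m : M), h • m = χ h • m := by
  have hbij : Function.Bijective (algebraMap k (Module.End k M)) := by
    obtain ⟨w, hw, hw'⟩ := finrank_eq_one_iff'.1 hM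
    have := nontrivial_of_ne w 0 hw
    refine ⟨FaithfulSMul.algebraMap_injective k _, fun φ => ?_⟩
    obtain ⟨c, hc⟩ := hw' (φ w)
    refine ⟨c, LinearMap.ext fun m => ?_⟩
    obtain ⟨d, rfl⟩ := hw' m
    rw [map_smul, map_smul, ← hc, Module.algebraMap_end_apply]
  let e := AlgEquiv.ofBijective (Algebra.ofId k (Module.End k M)) hbij
  refine ⟨(e.symm : Module.End k M →ₐ[k] k).comp (Algebra.lsmul k k M), fun h m => ?_⟩
  have := e.apply_symm_apply (Algebra.lsmul k k M h)
  have := congrArg (fun φ : Module.End k M => φ m) this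
  exact this.symm

/-- If `A` acts on `x ≠ 0` through the counit in a representation `ρ` of `H`, then `H x` is
finite-dimensional with `A` acting through the counit, and a simple submodule of `H x` is
one-dimensional by hypothesis. -/
lemma exists_eigenvector (hc : IsFiniteCentralizing A) (h1 : IrreduciblesOneDimensional A)
    {V : Type v} [AddCommGroup V] [Module k V] (ρ : H →ₐ[k] Module.End k V) {x : V}
    (hx : x ≠ 0) (hρ : ∀ a ∈ A, ρ a x = Coalgebra.counit (R := k) a • x) :
    ∃ (w : V) (χ : H →ₐ[k] k), w ≠ 0 ∧ (∀ a ∈ A, χ a = Coalgebra.counit (R := k) a) ∧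
      ∀ h : H, ρ h w = χ h • w := by
  let _ : Module H V := Module.compHom V ρ.toRingHom
  have : IsScalarTower k H V := ⟨fun c h y => by
    change ρ (c • h) y = c • ρ h y
    rw [map_smul, LinearMap.smul_apply]⟩
  have hAx : ∀ a ∈ A, a • x = Coalgebra.counit (R := k) a • x := hρ
  let W : Submodule H V := Submodule.span H {x}
  have hAW : ∀ a ∈ A, ∀ w ∈ W, a • w = Coalgebra.counit (R := k) a • w := by
    intro a ha w hw
    obtain ⟨h, rfl⟩ := Submodule.mem_span_singleton.1 hw
    refine hc.induction (p := fun h => a • h • x = Coalgebra.counit (R := k) a • h • x) (by simp)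
      (fun y z hy hz => by rw [add_smul, smul_add, smul_add, hy, hz]) (fun b r hr => ?_) h
    have hb : ∀ b : A, ((b : H) * r) • x = Coalgebra.counit (R := k) (b : H) • r • x := fun b => by
      rw [hr, mul_smul, hAx b b.2, smul_comm]
    have := hb (⟨a, ha⟩ * b)
    rw [hb, smul_comm, ← mul_smul a r, hb ⟨a, ha⟩, smul_comm]
  have hfin : Module.Finite k W := by
    obtain ⟨s, -, hspan⟩ := hc
    let g : H →ₗ[k] V := (LinearMap.toSpanSingleton H V x).restrictScalars k
    have hW : W.restrictScalars k ≤ Submodule.span k (g '' (s : Set H)) := by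
      intro y hy
      obtain ⟨h, rfl⟩ := Submodule.mem_span_singleton.1 hy
      have hh : h ∈ Submodule.span A (s : Set H) := hspan ▸ Submodule.mem_top
      clear hy
      induction hh using Submodule.span_induction with
      | mem r hr => exact Submodule.subset_span ⟨r, hr, rfl⟩
      | zero => simp
      | add y z _ _ hy hz => rw [add_smul]; exact Submodule.add_mem _ hy hz
      | smul a y _ hy =>
        rw [Subalgebra.smul_def, smul_eq_mul, mul_smul,
          hAW a a.2 _ (Submodule.mem_span_singleton.2 ⟨y, rfl⟩)]
        exact Submodule.smul_mem _ _ hy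
    have : Module.Finite k (Submodule.span k (g '' (s : Set H))) :=
      Module.Finite.span_of_finite k (s.finite_toSet.image g)
    exact Module.Finite.of_injective (Submodule.inclusion hW) (Submodule.inclusion_injective hW)
  have hart : IsArtinian H W := isArtinian_of_tower k inferInstance
  have hxW : x ∈ W := Submodule.mem_span_singleton_self x
  have hnt : Nontrivial W := ⟨⟨x, hxW⟩, 0, fun h => hx (congrArg Subtype.val h)⟩
  obtain ⟨S, hS⟩ := IsAtomic.exists_atom (Submodule H W)
  have hsimple : IsSimpleModule H S := isSimpleModule_iff_isAtom.2 hS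
  have hrank : Module.finrank k S = 1 := h1 S fun a ha m =>
    Subtype.ext (Subtype.ext (hAW a ha _ m.1.2))
  obtain ⟨χ, hχ⟩ := exists_algHom_of_finrank_eq_one (H := H) hrank
  have := IsSimpleModule.nontrivial H S
  obtain ⟨w, hw⟩ := exists_ne (0 : S)
  have hw' : (w : W).1 ≠ 0 := fun h => hw (Subtype.ext (Subtype.ext h))
  have hχ' : ∀ h : H, h • (w : W).1 = χ h • (w : W).1 := fun h =>
    congrArg (fun y : S => (y : W).1) (hχ h w)
  refine ⟨w.1.1, χ, hw', fun a ha => ?_, hχ'⟩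
  have := (hχ' a).symm.trans (hAW a ha _ w.1.2)
  exact smul_left_injective k hw' this

/-! ### The adjoint action on linear maps -/

section Adjoint

variable {N M : Type*} [AddCommGroup N] [Module k N] [Module H N] [IsScalarTower k H N]
  [AddCommGroup M] [Module k M] [Module H M] [IsScalarTower k H M]

variable (k H N M) in
/-- `H` acting on `Hom_k(N, M)` through the target. -/
noncomputable def postcomp : H →ₐ[k] Module.End k (N →ₗ[k] M) :=
  AlgHom.ofLinearMap (LinearMap.llcomp k N M M ∘ₗ (Algebra.lsmul k k M : H →ₐ[k] _).toLinearMap)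
    (by ext; simp) (fun x y => by ext; simp)

variable (k H N M) in
/-- `H` acting on `Hom_k(N, M)` through the antipode and the source. -/
noncomputable def precompAntipode : H →ₐ[k] Module.End k (N →ₗ[k] M) :=
  AlgHom.ofLinearMap ((LinearMap.llcomp k N N M).flip ∘ₗ
      (Algebra.lsmul k k N : H →ₐ[k] _).toLinearMap ∘ₗ HopfAlgebra.antipode k)
    (by ext; simp)
    (fun x y => by ext; simp [HopfAlgebra.antipode_mul_antidistrib])

lemma commute_postcomp (x y : H) :
    Commute (postcomp k H N M x) (precompAntipode k H N M y) := by
  ext; simp [postcomp, precompAntipode]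

variable (k H N M) in
/-- The adjoint action `(h · f)(n) = ∑ h₁ f(S(h₂) n)` of `H` on `Hom_k(N, M)`. -/
noncomputable def adjoint : H →ₐ[k] Module.End k (N →ₗ[k] M) :=
  (Algebra.TensorProduct.lift (postcomp k H N M) (precompAntipode k H N M)
    commute_postcomp).comp (Bialgebra.comulAlgHom k H)

/-- `A`-linear maps are invariant under the action of `A` on `Hom_k(N, M)`: as `a₁ ∈ A`, one has
`∑ a₁ f(S(a₂) n) = f(∑ a₁ S(a₂) n) = ε(a) f(n)`. -/
lemma adjoint_apply_of_linear (hA : IsRightCoideal A) {f : N →ₗ[k] M}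
    (hf : ∀ (a : A) (n : N), f ((a : H) • n) = (a : H) • f n) {a : H} (ha : a ∈ A) :
    adjoint k H N M a f = Coalgebra.counit (R := k) a • f := by
  obtain ⟨t, ht⟩ := hA a ha
  have h1 : ∀ (t : A ⊗[k] H) (n : N),
      Algebra.TensorProduct.lift (postcomp k H N M) (precompAntipode k H N M) commute_postcomp
        (LinearMap.rTensor H A.val.toLinearMap t) f n =
      f (LinearMap.mul' k H (LinearMap.lTensor H (HopfAlgebra.antipode k)
        (LinearMap.rTensor H A.val.toLinearMap t)) • n) := by
    intro t n
    induction t with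
    | zero => simp
    | add x y hx hy => simp only [map_add, LinearMap.add_apply, hx, hy, add_smul]
    | tmul x y => simp [postcomp, precompAntipode, mul_smul, hf]
  ext n
  have := h1 t n
  rw [ht, HopfAlgebra.mul_antipode_lTensor_comul_apply, algebraMap_smul, map_smul] at this
  exact this

/-- An eigenvector for the adjoint action on `Hom_k(N, M)` with character `χ` is `H`-linear after
twisting `N` by the winding automorphism `σ_χ`:
`h w(n) = ∑ h₁ w(S(h₂) h₃ n) = ∑ χ(h₁) w(h₂ n)`. -/
lemma smul_apply_of_eigenvector {w : N →ₗ[k] M} {χ : H →ₐ[k] k}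
    (hw : ∀ h : H, adjoint k H N M h w = χ h • w) (h : H) (n : N) :
    h • w n = w (windingHom χ h • n) := by
  let g : H ⊗[k] H →ₗ[k] M :=
    w ∘ₗ (LinearMap.toSpanSingleton H N n).restrictScalars k ∘ₗ LinearMap.mul' k H ∘ₗ
      LinearMap.rTensor H (HopfAlgebra.antipode k)
  let Φ : H ⊗[k] (H ⊗[k] H) →ₗ[k] M :=
    TensorProduct.lift ((Algebra.lsmul k k M : H →ₐ[k] _).toLinearMap.compl₂ g)
  have key := congrArg Φ (Coalgebra.coassoc_apply (R := k) h)
  have h0 : ∀ (u : H ⊗[k] H) (z : H), Φ (TensorProduct.assoc k H H H (u ⊗ₜ z)) =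
      Algebra.TensorProduct.lift (postcomp k H N M) (precompAntipode k H N M) commute_postcomp
        u w (z • n) := by
    intro u z
    induction u with
    | zero => simp
    | add x y hx hy => simp only [TensorProduct.add_tmul, map_add, LinearMap.add_apply, hx, hy]
    | tmul x y => simp [Φ, g, postcomp, precompAntipode, mul_smul]
  have h1 : ∀ t : H ⊗[k] H, Φ (TensorProduct.assoc k H H H (Coalgebra.comul.rTensor H t)) =
      w (TensorProduct.lid k H (TensorProduct.map χ.toLinearMap LinearMap.id t) • n) := by
    intro t
    induction t with
    | zero => simp
    | add x y hx hy => simp only [map_add, hx, hy, add_smul]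
    | tmul x z =>
      have := congrArg (fun φ : N →ₗ[k] M => φ (z • n)) (hw x)
      rw [LinearMap.rTensor_tmul, h0]
      simpa [adjoint] using this
  have h2 : ∀ t : H ⊗[k] H, Φ (Coalgebra.comul.lTensor H t) =
      TensorProduct.rid k H (Coalgebra.counit.lTensor H t) • w n := by
    intro t
    induction t with
    | zero => simp
    | add x y hx hy => simp only [map_add, hx, hy, add_smul]
    | tmul x y =>
      simp [Φ, g, HopfAlgebra.mul_antipode_rTensor_comul_apply]
  rw [h1, h2, Coalgebra.lTensor_counit_comul] at key
  rw [TensorProduct.rid_tmul, one_smul] at key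
  exact key.symm

end Adjoint

end Hopf

section Extension

variable {k : Type u} {H : Type v} [Field k] [Ring H] [Algebra k H] {A : Subalgebra k H}

/-! ### Linear maps between prime quotients -/

/-- Prime ideals with the same contraction are linked by a nonzero `A`-linear map between their
quotient rings, obtained from a layer of `H / P'` over `P ∩ A` and the inclusion of `A / (P ∩ A)`
in `H / P`. -/
lemma exists_linearMap_quotient (hc : IsFiniteCentralizing A) {P P' : TwoSidedIdeal H}
    (hP : IsPrimeIdeal P) (hPP' : contract A P' = contract A P) :
    ∃ f : (H ⧸ P'.asIdeal) →ₗ[k] (H ⧸ P.asIdeal), f ≠ 0 ∧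
      ∀ (a : A) (n : H ⧸ P'.asIdeal), f ((a : H) • n) = (a : H) • f n := by
  obtain ⟨K, r, b, hK, hL⟩ := exists_isLayer hc (isPrimeIdeal_contract hc hP)
    (P'.asIdeal.restrictScalars A) (fun x hx a => P'.mul_mem_right _ _ hx)
    (fun a ha => by
      rw [← hPP', mem_contract]
      simpa using ha 1)
  have huniq : ∀ n : H ⧸ P'.asIdeal, ∃ m : H ⧸ P.asIdeal, ∀ (h : H) (a : A),
      P'.asIdeal.mkQ h = n → h * (b : H) - a * r ∈ K → m = P.asIdeal.mkQ a := by
    intro n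
    obtain ⟨h₀, rfl⟩ := P'.asIdeal.mkQ_surjective n
    obtain ⟨a₀, ha₀⟩ := hL.exists_right h₀
    refine ⟨P.asIdeal.mkQ a₀, fun h a hh ha => ?_⟩
    have h1 : (h - h₀) * (b : H) ∈ K := hL.mul_mem _ (hK ((Submodule.Quotient.eq _).1 hh)) b
    have h2 : ((a₀ - a : A) : H) * r ∈ K := by
      convert K.add_mem (K.sub_mem ha ha₀) (K.neg_mem h1) using 1
      push_cast; noncomm_ring
    exact (Submodule.Quotient.eq _).2 (mem_contract.1 (hL.mem_of_mul_mem _ h2))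
  choose f hf using huniq
  refine ⟨⟨⟨f, fun n n' => ?_⟩, fun c n => ?_⟩, fun h0 => hL.notMem ?_, fun a n => ?_⟩
  · obtain ⟨h, rfl⟩ := P'.asIdeal.mkQ_surjective n
    obtain ⟨h', rfl⟩ := P'.asIdeal.mkQ_surjective n'
    obtain ⟨a, ha⟩ := hL.exists_right h
    obtain ⟨a', ha'⟩ := hL.exists_right h'
    rw [hf _ h a rfl ha, hf _ h' a' rfl ha', hf _ (h + h') (a + a') (map_add _ _ _) ?_]
    · simp
    · convert K.add_mem ha ha' using 1
      push_cast; noncomm_ring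
  · obtain ⟨h, rfl⟩ := P'.asIdeal.mkQ_surjective n
    obtain ⟨a, ha⟩ := hL.exists_right h
    refine (hf _ (c • h) (c • a) rfl ?_).trans (congrArg (c • ·) (hf _ h a rfl ha)).symm
    · convert K.smul_mem (algebraMap k A c) ha using 1
      simp [smul_sub]
  · have h1 : f (P'.asIdeal.mkQ r) = 0 := congrArg (fun φ => φ (P'.asIdeal.mkQ r)) h0
    rw [hf _ r b rfl (by simp [hL.comm])] at h1
    exact mem_contract.2 ((Submodule.Quotient.mk_eq_zero _).1 h1)
  · obtain ⟨h, rfl⟩ := P'.asIdeal.mkQ_surjective n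
    obtain ⟨c, hc⟩ := hL.exists_right h
    refine (hf _ ((a : H) * h) (a * c) rfl ?_).trans
      (congrArg ((a : H) • ·) (hf _ h c rfl hc)).symm
    · convert K.smul_mem a hc using 1
      rw [Subalgebra.smul_def, smul_eq_mul]
      push_cast; noncomm_ring

end Extension

section Hopf

variable {k : Type u} {H : Type v} [Field k] [Ring H] [HopfAlgebra k H] {A : Subalgebra k H}

/-! ### Orbits of winding automorphisms -/

/-- The action of a winding automorphism on ideals. -/
noncomputable def windingIdeal (χ : WithConv (H →ₐ[k] k)) :
    TwoSidedIdeal H ≃o TwoSidedIdeal H :=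
  (winding χ).toRingEquiv.mapTwoSidedIdeal

lemma mem_windingIdeal {χ : WithConv (H →ₐ[k] k)} {P : TwoSidedIdeal H} {h : H} :
    h ∈ windingIdeal χ P ↔ (winding χ).symm h ∈ P :=
  TwoSidedIdeal.mem_comap _

lemma mem_windingOrbit {X : Subgroup (WithConv (H →ₐ[k] k))} {P P' : TwoSidedIdeal H} :
    P' ∈ windingOrbit X P ↔ ∃ χ ∈ X, P' = windingIdeal χ P := Iff.rfl

lemma windingIdeal_symm (χ : WithConv (H →ₐ[k] k)) (P : TwoSidedIdeal H) :
    (windingIdeal χ).symm P = P.comap (winding χ).toRingEquiv := rfl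

lemma winding_mul (χ ψ : WithConv (H →ₐ[k] k)) (h : H) :
    winding (ψ * χ) h = winding χ (winding ψ h) :=
  (DFunLike.congr_fun (windingHom_comp χ ψ) h).symm

lemma windingIdeal_mul (χ ψ : WithConv (H →ₐ[k] k)) (P : TwoSidedIdeal H) :
    windingIdeal (ψ * χ) P = windingIdeal χ (windingIdeal ψ P) := by
  ext h
  rw [mem_windingIdeal, mem_windingIdeal, mem_windingIdeal]
  have : (winding (ψ * χ)).symm h = (winding ψ).symm ((winding χ).symm h) := by
    rw [AlgEquiv.symm_apply_eq, winding_mul]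
    simp
  rw [this]

lemma windingIdeal_one (P : TwoSidedIdeal H) :
    windingIdeal (1 : WithConv (H →ₐ[k] k)) P = P := by
  ext h
  rw [mem_windingIdeal]
  have : (winding (1 : WithConv (H →ₐ[k] k))).symm h = h := by
    rw [AlgEquiv.symm_apply_eq]
    exact (DFunLike.congr_fun windingHom_one h).symm
  rw [this]

lemma winding_eq_self {hA : IsRightCoideal A} {χ : WithConv (H →ₐ[k] k)}
    (hχ : χ ∈ restrictingCharacters A hA) {a : H} (ha : a ∈ A) : winding χ a = a :=
  windingHom_eq_self hA hχ ha

lemma contract_windingIdeal {hA : IsRightCoideal A} {χ : WithConv (H →ₐ[k] k)}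
    (hχ : χ ∈ restrictingCharacters A hA) (P : TwoSidedIdeal H) :
    contract A (windingIdeal χ P) = contract A P := by
  ext a
  rw [mem_contract, mem_contract, mem_windingIdeal,
    (AlgEquiv.symm_apply_eq _).2 (winding_eq_self hχ a.2).symm]

/-- Under the one-dimensionality hypothesis, an `A`-linear map `H / P' → H / P` can be replaced by
one that is `H`-linear up to a winding automorphism, because it generates a finite-dimensional
`H`-module under the adjoint action. -/
lemma exists_le_windingIdeal (hc : IsFiniteCentralizing A) (hA : IsRightCoideal A)
    (h1 : IrreduciblesOneDimensional A) {P P' : TwoSidedIdeal H} (hP : IsPrimeIdeal P)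
    (hPP' : contract A P' = contract A P) :
    ∃ χ ∈ restrictingCharacters A hA, P' ≤ windingIdeal χ P := by
  obtain ⟨f, hf0, hf⟩ := exists_linearMap_quotient hc hP hPP'
  obtain ⟨w, χ, hw0, hχ, hw⟩ := exists_eigenvector hc h1 (adjoint k H _ _) hf0
    fun a ha => adjoint_apply_of_linear hA hf ha
  refine ⟨WithConv.toConv χ, hχ, fun y hy => mem_windingIdeal.2 ?_⟩
  obtain ⟨q, rfl⟩ := (winding (WithConv.toConv χ)).surjective y
  rw [AlgEquiv.symm_apply_apply]
  obtain ⟨n, hn⟩ : ∃ n, w n ≠ 0 := by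
    by_contra! hcon
    exact hw0 (LinearMap.ext hcon)
  obtain ⟨m, hm⟩ := P.asIdeal.mkQ_surjective (w n)
  refine (hP.2 q m fun g => ?_).resolve_right fun hmP => hn ?_
  · have h2 : windingHom χ (q * g) • n = 0 := by
      obtain ⟨x, rfl⟩ := P'.asIdeal.mkQ_surjective n
      rw [map_mul]
      exact (Submodule.Quotient.mk_eq_zero _).2
        (P'.mul_mem_right _ _ (P'.mul_mem_right _ _ hy))
    have h3 := smul_apply_of_eigenvector hw (q * g) n
    rw [h2, map_zero, ← hm, ← map_smul] at h3
    exact (Submodule.Quotient.mk_eq_zero _).1 h3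
  · rw [← hm]
    exact (Submodule.Quotient.mk_eq_zero _).2 hmP

/-- Prime ideals with the same contraction are conjugate: each is contained in a conjugate of the
other, and since the group of characters is finite these inclusions are equalities. -/
lemma mem_windingOrbit_of_contract_eq (hc : IsFiniteCentralizing A) (hA : IsRightCoideal A)
    (h1 : IrreduciblesOneDimensional A) {P P' : TwoSidedIdeal H} (hP : IsPrimeIdeal P)
    (hP' : IsPrimeIdeal P') (hPP' : contract A P' = contract A P) :
    P' ∈ windingOrbit (restrictingCharacters A hA) P := by
  obtain ⟨χ, hχ, hle⟩ := exists_le_windingIdeal hc hA h1 hP hPP'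
  obtain ⟨ψ, hψ, hle'⟩ := exists_le_windingIdeal hc hA h1 hP' hPP'.symm
  refine mem_windingOrbit.2 ⟨χ, hχ, le_antisymm hle ?_⟩
  have h2 : windingIdeal χ P ≤ windingIdeal (ψ * χ) P' := by
    rw [windingIdeal_mul]
    exact (windingIdeal χ).monotone hle'
  refine h2.trans ?_
  have hle2 := hle.trans h2
  have : Finite (restrictingCharacters A hA) := finite_restrictingCharacters hc hA
  obtain ⟨n, hn, hpow⟩ := isOfFinOrder_iff_pow_eq_one.1
    (isOfFinOrder_of_finite (⟨ψ * χ, mul_mem hψ hχ⟩ : restrictingCharacters A hA))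
  replace hpow : (ψ * χ) ^ n = 1 := congrArg Subtype.val hpow
  generalize ψ * χ = g at *
  have hiter : ∀ m : ℕ, windingIdeal g P' ≤ windingIdeal (g ^ (m + 1)) P' := by
    intro m
    induction m with
    | zero => rw [zero_add, pow_one]
    | succ m ih =>
      rw [pow_succ _ (m + 1), windingIdeal_mul]
      exact (windingIdeal g).monotone (hle2.trans ih)
  have := hiter (n - 1)
  rwa [Nat.sub_add_cancel hn, hpow, windingIdeal_one] at this

/-- If a set `S` of prime ideals is stable under winding automorphisms and contracts onto `T`, then
the fibers of `S → T` are the orbits in `S`. -/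
lemma fiber_image_eq (hc : IsFiniteCentralizing A) (hA : IsRightCoideal A)
    (h1 : IrreduciblesOneDimensional A) {S : Set (TwoSidedIdeal H)} {T : Set (TwoSidedIdeal A)}
    (hS : S ⊆ spec H) (hstable : ∀ χ : WithConv (H →ₐ[k] k), ∀ P ∈ S, windingIdeal χ P ∈ S)
    (hmaps : Set.MapsTo (contract A) S T) (hsurj : Set.SurjOn (contract A) S T) :
    fiber A S '' T = windingOrbit (restrictingCharacters A hA) '' S := by
  have key : ∀ P ∈ S, fiber A S (contract A P) = windingOrbit (restrictingCharacters A hA) P := by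
    intro P hP
    ext P'
    constructor
    · rintro ⟨hP', hcon⟩
      exact mem_windingOrbit_of_contract_eq hc hA h1 (hS hP) (hS hP') hcon
    · rintro ⟨χ, hχ, rfl⟩
      exact ⟨hstable χ P hP, contract_windingIdeal hχ P⟩
  ext F
  constructor
  · rintro ⟨Q, hQ, rfl⟩
    obtain ⟨P, hP, rfl⟩ := hsurj hQ
    exact ⟨P, hP, (key P hP).symm⟩
  · rintro ⟨P, hP, rfl⟩
    exact ⟨_, hmaps hP, key P hP⟩

/-! ### The fiber over the augmentation ideal -/

/-- The kernel of a character is primitive. -/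
lemma isPrimitiveIdeal_ker (χ : H →ₐ[k] k) : IsPrimitiveIdeal (TwoSidedIdeal.ker χ) := by
  set P : TwoSidedIdeal H := TwoSidedIdeal.ker χ
  have mem_P : ∀ x, x ∈ P.asIdeal ↔ χ x = 0 := fun x => TwoSidedIdeal.mem_ker _
  have mk_zero : ∀ x, P.asIdeal.mkQ x = 0 ↔ χ x = 0 := fun x =>
    (Submodule.Quotient.mk_eq_zero _).trans (mem_P x)
  refine ⟨H ⧸ P.asIdeal, inferInstance, inferInstance, ?_, fun r => ?_⟩
  · refine isSimpleModule_iff_toSpanSingleton_surjective.2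
      ⟨⟨P.asIdeal.mkQ 1, 0, fun h => by simpa using (mk_zero 1).1 h⟩, fun y hy x => ?_⟩
    obtain ⟨y, rfl⟩ := P.asIdeal.mkQ_surjective y
    obtain ⟨x, rfl⟩ := P.asIdeal.mkQ_surjective x
    have hy' : χ y ≠ 0 := fun h => hy ((mk_zero y).2 h)
    refine ⟨(χ y)⁻¹ • x, (Submodule.Quotient.eq _).2 ((mem_P _).2 ?_)⟩
    change χ ((χ y)⁻¹ • x * y - x) = 0
    rw [map_sub, map_mul, map_smul, smul_eq_mul, mul_right_comm,
      inv_mul_cancel₀ hy', one_mul, sub_self]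
  · rw [show r ∈ P ↔ χ r = 0 from mem_P r]
    constructor
    · intro hr m
      obtain ⟨h, rfl⟩ := P.asIdeal.mkQ_surjective m
      rw [← map_smul, mk_zero]
      simp [hr]
    · intro hr
      have := hr (P.asIdeal.mkQ 1)
      rw [← map_smul, mk_zero] at this
      simpa using this

variable (k H) in
/-- The kernel of the counit. -/
noncomputable def counitIdeal : TwoSidedIdeal H := TwoSidedIdeal.ker (Bialgebra.counitAlgHom k H)

lemma mem_counitIdeal {h : H} : h ∈ counitIdeal k H ↔ Coalgebra.counit (R := k) h = 0 :=
  TwoSidedIdeal.mem_ker (Bialgebra.counitAlgHom k H)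

lemma isPrimitiveIdeal_counitIdeal : IsPrimitiveIdeal (counitIdeal k H) :=
  isPrimitiveIdeal_ker _

lemma contract_counitIdeal : contract A (counitIdeal k H) = augmentationIdeal A := by
  ext a
  rw [mem_contract, mem_counitIdeal]
  exact (TwoSidedIdeal.mem_ker ((Bialgebra.counitAlgHom k H).comp A.val)).symm

/-- If the primitive ideals over `A⁺` form a single orbit, they are the images of the kernel of the
counit under algebra automorphisms, so each irreducible module over `A⁺` has the kernel of a
character as its annihilator. -/
lemma irreduciblesOneDimensional_of_fiber_eq {X : Subgroup (WithConv (H →ₐ[k] k))}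
    {P : TwoSidedIdeal H} (h : fiber A (prim H) (augmentationIdeal A) = windingOrbit X P) :
    IrreduciblesOneDimensional A := by
  intro M _ _ _ _ hM hAM
  have := IsSimpleModule.nontrivial H M
  obtain ⟨m, hm⟩ := exists_ne (0 : M)
  have hmem : annIdeal H M ∈ fiber A (prim H) (augmentationIdeal A) := by
    refine ⟨isPrimitiveIdeal_annIdeal M, TwoSidedIdeal.ext fun a => ?_⟩
    rw [← contract_counitIdeal, mem_contract, mem_contract, mem_annIdeal, mem_counitIdeal]
    refine ⟨fun ha => ?_, fun ha x => by rw [hAM a a.2, ha, zero_smul]⟩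
    have := ha m
    rw [hAM a a.2] at this
    exact (smul_eq_zero.1 this).resolve_right hm
  have hmem' : counitIdeal k H ∈ fiber A (prim H) (augmentationIdeal A) :=
    ⟨isPrimitiveIdeal_counitIdeal, contract_counitIdeal⟩
  rw [h] at hmem hmem'
  obtain ⟨χ, -, hχ⟩ := mem_windingOrbit.1 hmem
  obtain ⟨ψ, -, hψ⟩ := mem_windingOrbit.1 hmem'
  let η : H →ₐ[k] k := ((Bialgebra.counitAlgHom k H).comp (winding ψ).toAlgHom).comp
    (winding χ).symm.toAlgHom
  have hη : ∀ x : H, η x = 0 → x • m = 0 := by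
    intro x hx
    refine mem_annIdeal.1 ?_ m
    rw [hχ, mem_windingIdeal]
    have h2 : winding ψ ((winding χ).symm x) ∈ counitIdeal k H := mem_counitIdeal.2 hx
    rwa [hψ, mem_windingIdeal, AlgEquiv.symm_apply_apply] at h2
  refine finrank_eq_one_iff'.2 ⟨m, hm, fun x => ?_⟩
  obtain ⟨y, rfl⟩ := exists_smul_eq_of_isSimpleModule (R := H) hm x
  refine ⟨η y, ?_⟩
  have := hη (y - algebraMap k H (η y)) (by simp)
  rw [sub_smul, algebraMap_smul, sub_eq_zero] at this
  exact this.symm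

/-- The fibers over `A⁺` in `prim H` and `spec H` agree as soon as the latter is an orbit: it
contains the kernel of the counit, so all its members are primitive. -/
lemma fiber_prim_eq_of_fiber_spec_eq {X : Subgroup (WithConv (H →ₐ[k] k))} {P : TwoSidedIdeal H}
    (h : fiber A (spec H) (augmentationIdeal A) = windingOrbit X P) :
    P ∈ prim H ∧ fiber A (prim H) (augmentationIdeal A) = windingOrbit X P := by
  have hmem : counitIdeal k H ∈ fiber A (spec H) (augmentationIdeal A) :=
    ⟨isPrimitiveIdeal_counitIdeal.isPrimeIdeal, contract_counitIdeal⟩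
  rw [h] at hmem
  obtain ⟨χ, -, hχ⟩ := mem_windingOrbit.1 hmem
  have hP : IsPrimitiveIdeal P := by
    rw [← (windingIdeal χ).symm_apply_apply P, ← hχ, windingIdeal_symm]
    exact isPrimitiveIdeal_counitIdeal.comap _
  refine ⟨hP, Set.Subset.antisymm
    (fun I hI => h ▸ (⟨hI.1.isPrimeIdeal, hI.2⟩ : I ∈ fiber A (spec H) _)) fun I hI => ?_⟩
  obtain ⟨ψ, -, hψ⟩ := mem_windingOrbit.1 hI
  rw [← h] at hI
  exact ⟨hψ ▸ hP.comap (winding ψ).toRingEquiv.symm, hI.2⟩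

end Hopf

end CentralizingHopf

theorem theorem2p9 {k : Type u} {H : Type v} [Field k] [Ring H] [HopfAlgebra k H]
    (hleft : IsNoetherianRing H) (hright : IsNoetherianRing Hᵐᵒᵖ)
    (A : Subalgebra k H) (hcent : CentralizingHopf.IsFiniteCentralizing A)
    (hA : CentralizingHopf.IsRightCoideal A)
    (X : Subgroup (WithConv (H →ₐ[k] k)))
    (hX : X = CentralizingHopf.restrictingCharacters A hA) :
    -- `X` is a finite group acting by winding automorphisms that fix `A` pointwise
    (Finite X ∧ ∀ χ ∈ X, ∀ a ∈ A, CentralizingHopf.winding χ a = a) ∧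
    -- contraction gives surjections `prim H → prim A` and `spec H → spec A`
    (Set.MapsTo (CentralizingHopf.contract A) (CentralizingHopf.prim H)
        (CentralizingHopf.prim A) ∧
      Set.SurjOn (CentralizingHopf.contract A) (CentralizingHopf.prim H)
        (CentralizingHopf.prim A)) ∧
    (Set.MapsTo (CentralizingHopf.contract A) (CentralizingHopf.spec H)
        (CentralizingHopf.spec A) ∧
      Set.SurjOn (CentralizingHopf.contract A) (CentralizingHopf.spec H)
        (CentralizingHopf.spec A)) ∧
    List.TFAE [
      CentralizingHopf.IrreduciblesOneDimensional A,
      ∃ P ∈ CentralizingHopf.prim H,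
        CentralizingHopf.fiber A (CentralizingHopf.prim H)
            (CentralizingHopf.augmentationIdeal A) =
          CentralizingHopf.windingOrbit X P,
      CentralizingHopf.fiber A (CentralizingHopf.prim H) '' CentralizingHopf.prim A =
        CentralizingHopf.windingOrbit X '' CentralizingHopf.prim H,
      CentralizingHopf.fiber A (CentralizingHopf.spec H) '' CentralizingHopf.spec A =
        CentralizingHopf.windingOrbit X '' CentralizingHopf.spec H] := by
  subst hX
  have hprim : Set.MapsTo (CentralizingHopf.contract A) (CentralizingHopf.prim H)
      (CentralizingHopf.prim A) := fun P hP => CentralizingHopf.isPrimitiveIdeal_contract hcent hP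
  have hprim' : Set.SurjOn (CentralizingHopf.contract A) (CentralizingHopf.prim H)
      (CentralizingHopf.prim A) := fun Q hQ =>
    CentralizingHopf.exists_isPrimitiveIdeal_contract_eq hcent hQ
  have hspec : Set.MapsTo (CentralizingHopf.contract A) (CentralizingHopf.spec H)
      (CentralizingHopf.spec A) := fun P hP => CentralizingHopf.isPrimeIdeal_contract hcent hP
  have hspec' : Set.SurjOn (CentralizingHopf.contract A) (CentralizingHopf.spec H)
      (CentralizingHopf.spec A) := fun Q hQ =>
    CentralizingHopf.exists_isPrimeIdeal_contract_eq hleft hcent hQ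
  have haug : CentralizingHopf.augmentationIdeal A ∈ CentralizingHopf.prim A :=
    CentralizingHopf.contract_counitIdeal (A := A) ▸
      hprim CentralizingHopf.isPrimitiveIdeal_counitIdeal
  refine ⟨⟨CentralizingHopf.finite_restrictingCharacters hcent hA,
    fun χ hχ a ha => CentralizingHopf.winding_eq_self hχ ha⟩, ⟨hprim, hprim'⟩, ⟨hspec, hspec'⟩, ?_⟩
  tfae_have 1 → 3 := fun h1 => CentralizingHopf.fiber_image_eq hcent hA h1
    (fun P hP => hP.isPrimeIdeal) (fun χ P hP => hP.comap _) hprim hprim'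
  tfae_have 1 → 4 := fun h1 => CentralizingHopf.fiber_image_eq hcent hA h1
    subset_rfl (fun χ P hP => hP.comap _) hspec hspec'
  tfae_have 3 → 2 := fun h3 => by
    obtain ⟨P, hP, hPfib⟩ := h3 ▸ Set.mem_image_of_mem (CentralizingHopf.fiber A _) haug
    exact ⟨P, hP, hPfib.symm⟩
  tfae_have 4 → 2 := fun h4 => by
    obtain ⟨P, -, hPfib⟩ :=
      h4 ▸ Set.mem_image_of_mem (CentralizingHopf.fiber A _) haug.isPrimeIdeal
    exact ⟨P, CentralizingHopf.fiber_prim_eq_of_fiber_spec_eq hPfib.symm⟩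
  tfae_have 2 → 1 := fun ⟨P, _, hPfib⟩ =>
    CentralizingHopf.irreduciblesOneDimensional_of_fiber_eq hPfib
  tfae_finish
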